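/- Let $n\ge 1$ and $1\le d\le p$ be integers, let $\lambda_1\ge\dots\ge\lambda_p>0$ and $\Lambda=\operatorname{diag}(\lambda_1,\dots,\lambda_p)$. For $U$ in the orthogonal group $O(p)$ with columns $u_1,\dots,u_p$ let $\mathbb{P}_U=\mathcal{N}(0,U\Lambda U^T)^{\otimes n}$ be the law of a sample $(X_1,\dots,X_n)$ of independent $\mathcal{N}(0,U\Lambda U^T)$-distributed vectors in $\mathbb{R}^p$, let $\mathbb{E}_U$ denote expectation under $\mathbb{P}_U$, and put $P_{\le d}(U)=\sum_{i\le d}u_iu_i^T$. Let $\|a\|_2^2=\operatorname{tr}(a^Ta)$ be the squared Hilbert–Schmidt norm and $dU$ the Haar probability measure on $O(p)$. Then, for each $\delta>0$, $$\inf_{\hat P}\int_{O(p)}\mathbb{E}_U\|\hat P-P_{\le d}(U)\|_2^2\,dU\ \ge\ I_\delta ,$$ where the infimum is taken over all $\mathbb{R}^{p\times p}$-valued estimators $\hat P=\hat P(X_1,\dots,X_n)$ (that is, measurable functions of the sample) and $$I_\delta=\frac{1}{1+2\delta}\max\Big\{\sum_{i\le d}\sum_{j>d}x_{ij}\Big\},$$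 the maximum (which is attained) being over all real matrices $(x_{ij})_{i\le d<j\le p}$ such that $$0\le x_{ij}\le \frac{2}{n}\frac{\lambda_i\lambda_j}{(\lambda_i-\lambda_j)^2}\ \ (i\le d<j),\qquad \sum_{i\le d}x_{ij}\le\delta\ \ (j>d),\qquad \sum_{j>d}x_{ij}\le\delta\ \ (i\le d);$$ here the upper bound on $x_{ij}$ is read as $+\infty$ if $\lambda_i=\lambda_j$, and empty sums are $0$. In particular, $I_1=\frac13\max\sum_{i\le d}\sum_{j>d}x_{ij}$, the maximum being over all doubly substochastic matrices $(x_{ij})_{i\le d<j\le p}$ (nonnegative entries, all row and column sums at most $1$) with $x_{ij}\le \frac{2}{n}\frac{\lambda_i\lambda_j}{(\lambda_i-\lambda_j)^2}$ for all $i\le d<j$. -/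

import Mathlib

open MeasureTheory ProbabilityTheory
open scoped ENNReal

noncomputable section

namespace PCABound

/-- The orthogonal group `O(p)` of real `p × p` matrices. -/
abbrev Orth (p : ℕ) := Matrix.orthogonalGroup (Fin p) ℝ

instance instMeasurableSpaceOrth (p : ℕ) : MeasurableSpace (Orth p) := borel _

instance instBorelSpaceOrth (p : ℕ) : BorelSpace (Orth p) := ⟨rfl⟩

instance instCompactSpaceOrth (p : ℕ) : CompactSpace (Orth p) := by
  have hK : IsCompact (Set.univ.pi fun _ : Fin p => Set.univ.pi fun _ : Fin p =>
      Set.Icc (-1 : ℝ) 1) :=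
    isCompact_univ_pi fun _ => isCompact_univ_pi fun _ => isCompact_Icc
  refine isCompact_iff_compactSpace.mp (IsCompact.of_isClosed_subset hK ?_ ?_)
  · exact isClosed_unitary (R := Matrix (Fin p) (Fin p) ℝ)
  · intro U hU i _ j _
    have h := entry_norm_bound_of_unitary (𝕜 := ℝ) (U := U) hU i j
    exact abs_le.mp h

/-- The Haar measure on `O(p)`, normalized to have total mass one. -/
def haarOrth (p : ℕ) : Measure (Orth p) := Measure.haarMeasure ⊤

instance instIsProbabilityMeasureHaarOrth (p : ℕ) : IsProbabilityMeasure (haarOrth p) := by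
  constructor
  have h := Measure.haarMeasure_self (G := Orth p) (K₀ := ⊤)
  simpa [haarOrth] using h

/-- The sample space `(ℝ^p)^n`, i.e. the space of `(X₁, …, Xₙ)`. -/
abbrev Sample (p n : ℕ) := Fin n → EuclideanSpace ℝ (Fin p)

/-- The covariance matrix `U Λ Uᵀ` with `Λ = diag(λ₁, …, λ_p)`. -/
def covMatrix {p : ℕ} (lam : Fin p → ℝ) (U : Orth p) : Matrix (Fin p) (Fin p) ℝ :=
  (U : Matrix (Fin p) (Fin p) ℝ) * Matrix.diagonal lam * (U : Matrix (Fin p) (Fin p) ℝ).transpose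

/-- The law `P_U = N(0, U Λ Uᵀ)^{⊗ n}`. -/
def model {p : ℕ} (n : ℕ) (lam : Fin p → ℝ) (U : Orth p) : Measure (Sample p n) :=
  Measure.pi fun _ : Fin n => multivariateGaussian 0 (covMatrix lam U)

/-- The projection `P_{≤ d}(U) = ∑_{i ≤ d} uᵢ uᵢᵀ`, with `u₁, …, u_p` the columns of `U`
(indices are shifted by one, since `Fin p` starts at zero). -/
def projLE {p : ℕ} (d : ℕ) (U : Orth p) : Matrix (Fin p) (Fin p) ℝ :=
  ∑ i : Fin p with i.val < d,
    Matrix.vecMulVec ((U : Matrix (Fin p) (Fin p) ℝ).col i) ((U : Matrix (Fin p) (Fin p) ℝ).col i)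

/-- The squared Hilbert-Schmidt norm `‖a‖₂² = tr(aᵀ a)`. -/
def hsNormSq {p : ℕ} (a : Matrix (Fin p) (Fin p) ℝ) : ℝ := (a.transpose * a).trace

/-- The matrix-valued estimators: (entrywise) measurable maps from the sample space to
`ℝ^{p × p}`. -/
def Estimator (p n : ℕ) :=
  {f : Sample p n → Matrix (Fin p) (Fin p) ℝ // ∀ k l, Measurable fun X => f X k l}

/-- The Haar-averaged risk `∫_{O(p)} E_U ‖P̂ - P_{≤ d}(U)‖₂² dU`, with values in `[0, ∞]`. -/
def bayesRisk {p n : ℕ} (d : ℕ) (lam : Fin p → ℝ) (Phat : Estimator p n) : ℝ≥0∞ :=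
  ∫⁻ U, ∫⁻ X, ENNReal.ofReal (hsNormSq (Phat.1 X - projLE d U)) ∂(model n lam U) ∂(haarOrth p)

/-- The indices `i ≤ d`. -/
abbrev Low (p d : ℕ) := {i : Fin p // i.val < d}

/-- The indices `j > d`. -/
abbrev High (p d : ℕ) := {j : Fin p // d ≤ j.val}

/-- The entry bounds `x_{ij} ≤ (2/n) λᵢ λⱼ / (λᵢ - λⱼ)²` for `i ≤ d < j`; the right-hand side
is `+∞`, hence there is no restriction, if `λᵢ = λⱼ`. -/
def EntryBounds {p : ℕ} (n d : ℕ) (lam : Fin p → ℝ) (x : Matrix (Low p d) (High p d) ℝ) : Prop :=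
  ∀ (i : Low p d) (j : High p d), lam i.1 ≠ lam j.1 →
    x i j ≤ 2 / (n : ℝ) * (lam i.1 * lam j.1 / (lam i.1 - lam j.1) ^ 2)

/-- The constraints of the maximization problem. -/
structure Feasible {p : ℕ} (n d : ℕ) (lam : Fin p → ℝ) (δ : ℝ)
    (x : Matrix (Low p d) (High p d) ℝ) : Prop where
  nonneg : ∀ i j, 0 ≤ x i j
  entry_le : EntryBounds n d lam x
  sum_low_le : ∀ j, ∑ i, x i j ≤ δ
  sum_high_le : ∀ i, ∑ j, x i j ≤ δ

/-- The values `∑_{i ≤ d} ∑_{j > d} x_{ij}` over all feasible `x`. -/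
def objectiveValues {p : ℕ} (n d : ℕ) (lam : Fin p → ℝ) (δ : ℝ) : Set ℝ :=
  {s | ∃ x : Matrix (Low p d) (High p d) ℝ, Feasible n d lam δ x ∧ s = ∑ i, ∑ j, x i j}

/-- The quantity `I_δ`. -/
def lowerBound {p : ℕ} (n d : ℕ) (lam : Fin p → ℝ) (δ : ℝ) : ℝ :=
  1 / (1 + 2 * δ) * sSup (objectiveValues n d lam δ)

/-- Doubly substochastic (not necessarily square) matrices. -/
structure IsDoublySubstochastic {ι κ : Type*} [Fintype ι] [Fintype κ] (x : Matrix ι κ ℝ) :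
    Prop where
  nonneg : ∀ i j, 0 ≤ x i j
  sum_col_le : ∀ j, ∑ i, x i j ≤ 1
  sum_row_le : ∀ i, ∑ j, x i j ≤ 1

end PCABound

end

/-! The bound is a Cramér–Rao (van Trees) inequality for the Haar prior. In the frame of `U`, the
loss of an estimate `M` is the squared distance of `A = Uᵀ M U` to the constant matrix `E = diag(1,
…, 1, 0, …, 0)`, because conjugation by `U` preserves the Hilbert–Schmidt norm.

Fix the sample and rotate columns `i ≤ d < j` of `U` into each other. Right invariance makes the
Haar integral of such a derivative vanish. Applied to the likelihood times `A i j + A j i`, this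
shows that `T i j = score * (A i j + A j i) + 2 * (A i i - A j j)` has mean zero against the
likelihood (`integral_exp_neg_quad_mul_score`). The estimate enters only as a fixed matrix, so no
regularity in the sample beyond measurability is needed.

At `A = E` one has `T i j = 2`. Hence an estimator with small loss would force the mean of `T i j`
away from zero. Completing squares with weights `c i j` quantifies this
(`four_mul_sum_le_sum_sq_add_penalty`): the sum `4 θ ∑ c` is at most the loss, plus `θ²` times a
penalty, up to a combination of the `T i j`.

The score has second moment `n (λᵢ - λⱼ)² / (λᵢ λⱼ)`, so the entry bounds on `c` say exactly that
`c` is at most two over the Fisher information. Together with the row and column bounds, the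
expected penalty is then at most `4 (1 + 2δ) ∑ c`. Optimizing over `θ` gives `∑ c / (1 + 2δ)` for
every feasible `c`. Compactness of the feasible set supplies a maximizer. -/

noncomputable section

namespace PCABound

/-! ### Integration by parts for the Haar measure -/

/-- The Haar probability measure of a compact group is also right invariant. -/
theorem map_mul_right_haarOrth {p : ℕ} (g : Orth p) :
    (haarOrth p).map (fun U => U * g) = haarOrth p := by
  have h1 : (haarOrth p).IsHaarMeasure := by unfold haarOrth; infer_instance
  have h2 : ((haarOrth p).map (fun U => U * g)).IsHaarMeasure :=
    Measure.isHaarMeasure_map_mul_right _ g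
  have h3 : IsProbabilityMeasure ((haarOrth p).map (fun U => U * g)) :=
    Measure.isProbabilityMeasure_map (measurable_mul_const g).aemeasurable
  exact Measure.isHaarMeasure_eq_of_isProbabilityMeasure _ _

theorem integral_haarOrth_mul_right {p : ℕ} (f : Orth p → ℝ) (g : Orth p) :
    ∫ U, f (U * g) ∂(haarOrth p) = ∫ U, f U ∂(haarOrth p) := by
  have h := (Homeomorph.mulRight g).measurableEmbedding.integral_map (μ := haarOrth p) f
  rw [Homeomorph.coe_mulRight, map_mul_right_haarOrth] at h
  exact h.symm

theorem integrable_haarOrth_of_continuous {p : ℕ} {f : Orth p → ℝ} (hf : Continuous f) :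
    Integrable f (haarOrth p) :=
  hf.integrable_of_hasCompactSupport (HasCompactSupport.of_compactSpace f)

/-- The derivative of a function along a one-parameter subgroup of `O(p)` has Haar integral zero. -/
theorem integral_haarOrth_deriv_eq_zero {p : ℕ} {R : ℝ → Orth p}
    (hR : ∀ s t, R s * R t = R (s + t)) {f f' : Orth p → ℝ} (hf : Continuous f)
    (hf' : Continuous f') (hd : ∀ U, HasDerivAt (fun t => f (U * R t)) (f' U) 0) :
    ∫ U, f' U ∂(haarOrth p) = 0 := by
  obtain ⟨C, hC⟩ := isCompact_univ.exists_bound_of_continuousOn hf'.continuousOn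
  -- The group law moves the derivative at time `t` back to time `0` at the base point `U * R t`.
  -- Since `O(p)` is compact, one constant then dominates all these derivatives.
  have hd' : ∀ (U : Orth p) (t : ℝ), HasDerivAt (fun t => f (U * R t)) (f' (U * R t)) t := by
    intro U t
    have h := hd (U * R t)
    have h2 := HasDerivAt.comp_sub_const t t (f := fun s => f (U * R t * R s))
      (f' := f' (U * R t)) (by simpa using h)
    refine h2.congr_of_eventuallyEq (Filter.Eventually.of_forall fun s => ?_)
    simp only [mul_assoc, hR, add_sub_cancel]
  have key := hasDerivAt_integral_of_dominated_loc_of_deriv_le (μ := haarOrth p)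
    (F := fun t U => f (U * R t)) (F' := fun t U => f' (U * R t)) (x₀ := 0)
    (s := Set.univ) (bound := fun _ => C) Filter.univ_mem
    (Filter.Eventually.of_forall fun t =>
      (hf.comp (continuous_mul_const (R t))).aestronglyMeasurable)
    (integrable_haarOrth_of_continuous (hf.comp (continuous_mul_const (R 0))))
    (hf'.comp (continuous_mul_const (R 0))).aestronglyMeasurable
    (Filter.Eventually.of_forall fun U t _ => hC _ (Set.mem_univ _))
    (integrable_const C)
    (Filter.Eventually.of_forall fun U t _ => hd' U t)
  have h2 := key.2
  -- By right invariance the integral of `f (U * R t)` does not depend on `t`, so its derivative is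
  -- zero.
  simp only [integral_haarOrth_mul_right] at h2
  exact h2.unique (hasDerivAt_const _ _)

/-! ### Plane rotations -/

/-- The rotation by the angle `t` in the plane of the `i`th and `j`th coordinates. -/
def rotMatrix {p : ℕ} (i j : Fin p) (t : ℝ) : Matrix (Fin p) (Fin p) ℝ := fun a b =>
  if b = i then (if a = i then Real.cos t else 0) - (if a = j then Real.sin t else 0)
  else if b = j then (if a = i then Real.sin t else 0) + (if a = j then Real.cos t else 0)
  else if a = b then 1 else 0

theorem mul_rotMatrix_apply {p : ℕ} (i j : Fin p) (t : ℝ) (A : Matrix (Fin p) (Fin p) ℝ)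
    (a b : Fin p) :
    (A * rotMatrix i j t) a b = if b = i then A a i * Real.cos t - A a j * Real.sin t
      else if b = j then A a i * Real.sin t + A a j * Real.cos t else A a b := by
  rw [Matrix.mul_apply]
  unfold rotMatrix
  split_ifs with h1 h2
  · simp [mul_sub, Finset.sum_sub_distrib]
  · simp [mul_add, Finset.sum_add_distrib]
  · simp

theorem rotMatrix_mul_rotMatrix {p : ℕ} {i j : Fin p} (hij : i ≠ j) (s t : ℝ) :
    rotMatrix i j s * rotMatrix i j t = rotMatrix i j (s + t) := by
  ext a b
  rw [mul_rotMatrix_apply]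
  simp only [rotMatrix, Real.cos_add, Real.sin_add, hij.symm, if_true, if_false]
  split_ifs <;> ring

theorem rotMatrix_zero {p : ℕ} {i j : Fin p} : rotMatrix i j 0 = 1 := by
  ext a b
  simp only [rotMatrix, Matrix.one_apply, Real.cos_zero, Real.sin_zero]
  split_ifs <;> grind

theorem transpose_rotMatrix {p : ℕ} {i j : Fin p} (hij : i ≠ j) (t : ℝ) :
    (rotMatrix i j t).transpose = rotMatrix i j (-t) := by
  ext a b
  simp only [Matrix.transpose_apply, rotMatrix, Real.cos_neg, Real.sin_neg]
  split_ifs <;> grind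

/-- `rotMatrix` as an element of `O(p)`. -/
def rot {p : ℕ} {i j : Fin p} (hij : i ≠ j) (t : ℝ) : Orth p :=
  ⟨rotMatrix i j t, by
    rw [Matrix.mem_orthogonalGroup_iff, transpose_rotMatrix hij, rotMatrix_mul_rotMatrix hij,
      add_neg_cancel, rotMatrix_zero]⟩

theorem rot_mul_rot {p : ℕ} {i j : Fin p} (hij : i ≠ j) (s t : ℝ) :
    rot hij s * rot hij t = rot hij (s + t) :=
  Subtype.ext (rotMatrix_mul_rotMatrix hij s t)

theorem rot_zero {p : ℕ} {i j : Fin p} (hij : i ≠ j) : rot hij 0 = 1 :=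
  Subtype.ext rotMatrix_zero

/-! ### The score identity for a fixed sample -/

/-- The coordinates `Uᵀ x` of `x` in the basis of the columns of `U`. -/
def coord {p : ℕ} (U : Orth p) (x : EuclideanSpace ℝ (Fin p)) (a : Fin p) : ℝ :=
  ∑ b, x b * (U : Matrix (Fin p) (Fin p) ℝ) b a

/-- The matrix `Uᵀ M U` of `M` in the basis of the columns of `U`. -/
def frame {p : ℕ} (M : Matrix (Fin p) (Fin p) ℝ) (U : Orth p) : Matrix (Fin p) (Fin p) ℝ :=
  (U : Matrix (Fin p) (Fin p) ℝ).transpose * M * (U : Matrix (Fin p) (Fin p) ℝ)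

/-- The quadratic form in the exponent of the Gaussian density. -/
def quad {p n : ℕ} (lam : Fin p → ℝ) (U : Orth p) (X : Sample p n) : ℝ :=
  ∑ k, ∑ a, coord U (X k) a ^ 2 / (2 * lam a)

/-- The derivative of the log-likelihood along the rotation of the `i`th and `j`th columns. -/
def score {p n : ℕ} (lam : Fin p → ℝ) (i j : Fin p) (U : Orth p) (X : Sample p n) : ℝ :=
  (1 / lam i - 1 / lam j) * ∑ k, coord U (X k) i * coord U (X k) j

theorem coord_mul_rot {p : ℕ} {i j : Fin p} (hij : i ≠ j) (t : ℝ) (U : Orth p)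
    (x : EuclideanSpace ℝ (Fin p)) (a : Fin p) :
    coord (U * rot hij t) x a =
      if a = i then coord U x i * Real.cos t - coord U x j * Real.sin t
      else if a = j then coord U x i * Real.sin t + coord U x j * Real.cos t
      else coord U x a := by
  have h : ∀ b, ((U * rot hij t : Orth p) : Matrix (Fin p) (Fin p) ℝ) b a = _ :=
    fun b => mul_rotMatrix_apply i j t U b a
  simp only [coord, h]
  split_ifs
  · simp only [mul_sub, Finset.sum_sub_distrib, Finset.sum_mul, mul_assoc]
  · simp only [mul_add, Finset.sum_add_distrib, Finset.sum_mul, mul_assoc]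
  · rfl

/-- The double transpose expresses conjugation by the rotation through right multiplications alone,
so that `mul_rotMatrix_apply` suffices to compute all entries. -/
theorem frame_mul_rot {p : ℕ} {i j : Fin p} (hij : i ≠ j) (t : ℝ) (U : Orth p)
    (M : Matrix (Fin p) (Fin p) ℝ) :
    frame M (U * rot hij t) =
      ((frame M U * rotMatrix i j t).transpose * rotMatrix i j t).transpose := by
  simp [frame, rot, Matrix.transpose_mul, Matrix.mul_assoc]

theorem hasDerivAt_coord_mul_rot {p : ℕ} {i j : Fin p} (hij : i ≠ j) (U : Orth p)
    (x : EuclideanSpace ℝ (Fin p)) (a : Fin p) :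
    HasDerivAt (fun t => coord (U * rot hij t) x a)
      ((if a = i then -coord U x j else 0) + (if a = j then coord U x i else 0)) 0 := by
  have hc := Real.hasDerivAt_cos 0
  have hs := Real.hasDerivAt_sin 0
  simp only [coord_mul_rot]
  by_cases h1 : a = i
  · have h2 : a ≠ j := fun h => hij (h1.symm.trans h)
    simp only [h1, hij, if_true, if_false]
    refine ((hc.const_mul _).sub (hs.const_mul _)).congr_deriv ?_
    simp
  · by_cases h2 : a = j
    · simp only [h2, hij.symm, if_true, if_false]
      refine ((hs.const_mul _).add (hc.const_mul _)).congr_deriv ?_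
      simp
    · simp only [h1, h2, if_false, add_zero]
      exact hasDerivAt_const _ _

theorem hasDerivAt_quad_mul_rot {p n : ℕ} {lam : Fin p → ℝ} {i j : Fin p} (hij : i ≠ j)
    (U : Orth p) (X : Sample p n) :
    HasDerivAt (fun t => quad lam (U * rot hij t) X) (-score lam i j U X) 0 := by
  unfold quad
  refine (HasDerivAt.fun_sum fun k _ => HasDerivAt.fun_sum fun a _ =>
    ((hasDerivAt_coord_mul_rot hij U (X k) a).pow 2).div_const (2 * lam a)).congr_deriv ?_
  -- Only the squares of coordinates `i` and `j` vary. Their derivatives are opposite up to the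
  -- weights `1 / lam i` and `1 / lam j`, which is why the score vanishes for equal eigenvalues.
  have h : ∀ k a, (2 : ℕ) * coord (U * rot hij 0) (X k) a ^ (2 - 1) *
      ((if a = i then -coord U (X k) j else 0) + (if a = j then coord U (X k) i else 0)) /
        (2 * lam a) =
      (if a = i then -(1 / lam i * (coord U (X k) i * coord U (X k) j)) else 0) +
      (if a = j then 1 / lam j * (coord U (X k) i * coord U (X k) j) else 0) := by
    intro k a
    rw [rot_zero, mul_one]
    split_ifs with h1 h2 h2
    · exact absurd (h1.symm.trans h2) hij
    · subst h1; field_simp; simp; ring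
    · subst h2; field_simp; simp; ring
    · simp
  simp only [h, Finset.sum_add_distrib, Finset.sum_ite_eq', Finset.mem_univ, if_true,
    Finset.sum_neg_distrib, ← Finset.mul_sum, score]
  ring

/-- Both off-diagonal entries have derivative `A i i - A j j` for `A = frame M U`. Using their sum
lets the squares of both be spent on the score term later; `M` need not be symmetric. -/
theorem hasDerivAt_frame_mul_rot {p : ℕ} {i j : Fin p} (hij : i ≠ j) (U : Orth p)
    (M : Matrix (Fin p) (Fin p) ℝ) :
    HasDerivAt (fun t => frame M (U * rot hij t) i j + frame M (U * rot hij t) j i)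
      (2 * (frame M U i i - frame M U j j)) 0 := by
  have hc := Real.hasDerivAt_cos 0
  have hs := Real.hasDerivAt_sin 0
  simp only [frame_mul_rot, Matrix.transpose_apply, mul_rotMatrix_apply, hij.symm, if_true,
    if_false]
  generalize frame M U = A
  refine ((((((hs.const_mul (A i i)).add (hc.const_mul (A i j))).mul hc).sub
    (((hs.const_mul (A j i)).add (hc.const_mul (A j j))).mul hs))).add
    ((((hc.const_mul (A i i)).sub (hs.const_mul (A i j))).mul hs).add
    (((hc.const_mul (A j i)).sub (hs.const_mul (A j j))).mul hc))).congr_deriv ?_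
  simp
  ring

theorem continuous_coe_apply {p : ℕ} (a b : Fin p) :
    Continuous fun U : Orth p => (U : Matrix (Fin p) (Fin p) ℝ) a b :=
  continuous_subtype_val.matrix_elem a b

theorem continuous_coord {p : ℕ} (a : Fin p) :
    Continuous fun z : Orth p × EuclideanSpace ℝ (Fin p) => coord z.1 z.2 a := by
  unfold coord
  refine continuous_finsetSum _ fun b _ => ?_
  exact Continuous.mul (by fun_prop) ((continuous_coe_apply b a).comp continuous_fst)

theorem continuous_coord_sample {p n : ℕ} (a : Fin p) (k : Fin n) :
    Continuous fun z : Orth p × Sample p n => coord z.1 (z.2 k) a :=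
  (continuous_coord a).comp (by fun_prop : Continuous fun z : Orth p × Sample p n => (z.1, z.2 k))

theorem continuous_quad {p n : ℕ} (lam : Fin p → ℝ) :
    Continuous fun z : Orth p × Sample p n => quad lam z.1 z.2 := by
  unfold quad
  exact continuous_finsetSum _ fun k _ => continuous_finsetSum _ fun a _ =>
    ((continuous_coord_sample a k).pow 2).div_const _

theorem continuous_score {p n : ℕ} (lam : Fin p → ℝ) (i j : Fin p) :
    Continuous fun z : Orth p × Sample p n => score lam i j z.1 z.2 := by
  unfold score
  exact continuous_const.mul (continuous_finsetSum _ fun k _ =>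
    (continuous_coord_sample i k).mul (continuous_coord_sample j k))

theorem continuous_quad_left {p n : ℕ} (lam : Fin p → ℝ) (X : Sample p n) :
    Continuous fun U : Orth p => quad lam U X := by
  have hX : Continuous fun U : Orth p => (U, X) := by fun_prop
  have h := (continuous_quad (n := n) lam).comp hX
  simpa only [Function.comp_def] using h

theorem continuous_score_left {p n : ℕ} (lam : Fin p → ℝ) (i j : Fin p) (X : Sample p n) :
    Continuous fun U : Orth p => score lam i j U X := by
  have hX : Continuous fun U : Orth p => (U, X) := by fun_prop
  have h := (continuous_score (n := n) lam i j).comp hX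
  simpa only [Function.comp_def] using h

theorem continuous_frame {p : ℕ} (M : Matrix (Fin p) (Fin p) ℝ) : Continuous (frame M) := by
  unfold frame
  exact (continuous_subtype_val.matrix_transpose.matrix_mul continuous_const).matrix_mul
    continuous_subtype_val

/-- Integration by parts along the rotation of the `i`th and `j`th columns. -/
theorem integral_exp_neg_quad_mul_score {p n : ℕ} {lam : Fin p → ℝ} {i j : Fin p} (hij : i ≠ j)
    (X : Sample p n) (M : Matrix (Fin p) (Fin p) ℝ) :
    ∫ U, Real.exp (-quad lam U X) * (score lam i j U X * (frame M U i j + frame M U j i) +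
      2 * (frame M U i i - frame M U j j)) ∂(haarOrth p) = 0 := by
  have hq := continuous_quad_left lam X
  have hs := continuous_score_left lam i j X
  have hm : ∀ a b, Continuous fun U : Orth p => frame M U a b :=
    fun a b => (continuous_frame M).matrix_elem a b
  refine integral_haarOrth_deriv_eq_zero (R := rot hij) (rot_mul_rot hij)
    (f := fun U => Real.exp (-quad lam U X) * (frame M U i j + frame M U j i)) ?_ ?_ ?_
  · exact (Real.continuous_exp.comp hq.neg).mul ((hm i j).add (hm j i))
  · exact (Real.continuous_exp.comp hq.neg).mul ((hs.mul ((hm i j).add (hm j i))).add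
      (continuous_const.mul ((hm i i).sub (hm j j))))
  · intro U
    refine ((hasDerivAt_quad_mul_rot hij U X).neg.exp.mul
      (hasDerivAt_frame_mul_rot hij U M)).congr_deriv ?_
    simp only [rot_zero, mul_one, Pi.neg_apply]
    ring

/-! ### The pointwise lower bound for the loss -/

theorem transpose_mul_self_coe {p : ℕ} (U : Orth p) :
    (U : Matrix (Fin p) (Fin p) ℝ).transpose * (U : Matrix (Fin p) (Fin p) ℝ) = 1 := by
  have h := (Matrix.mem_orthogonalGroup_iff' (Fin p) ℝ).mp U.2
  exact h

theorem mul_transpose_self_coe {p : ℕ} (U : Orth p) :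
    (U : Matrix (Fin p) (Fin p) ℝ) * (U : Matrix (Fin p) (Fin p) ℝ).transpose = 1 := by
  have h := (Matrix.mem_orthogonalGroup_iff (Fin p) ℝ).mp U.2
  exact h

theorem projLE_eq_mul {p : ℕ} (d : ℕ) (U : Orth p) :
    projLE d U = (U : Matrix (Fin p) (Fin p) ℝ) *
      Matrix.diagonal (fun a : Fin p => if a.val < d then (1 : ℝ) else 0) *
      (U : Matrix (Fin p) (Fin p) ℝ).transpose := by
  ext a b
  rw [projLE, Matrix.sum_apply, Finset.sum_filter, Matrix.mul_apply]
  refine Finset.sum_congr rfl fun c _ => ?_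
  simp [Matrix.vecMulVec_apply, Matrix.mul_diagonal]

theorem frame_projLE {p : ℕ} (d : ℕ) (U : Orth p) :
    frame (projLE d U) U = Matrix.diagonal (fun a : Fin p => if a.val < d then (1 : ℝ) else 0) := by
  have h := transpose_mul_self_coe U
  simp only [frame, projLE_eq_mul, Matrix.mul_assoc, h, Matrix.mul_one]
  rw [← Matrix.mul_assoc, h, Matrix.one_mul]

theorem hsNormSq_eq_sum {p : ℕ} (a : Matrix (Fin p) (Fin p) ℝ) :
    hsNormSq a = ∑ i, ∑ j, a i j ^ 2 := by
  rw [Finset.sum_comm]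
  simp [hsNormSq, Matrix.trace, Matrix.mul_apply, sq]

theorem hsNormSq_nonneg {p : ℕ} (a : Matrix (Fin p) (Fin p) ℝ) : 0 ≤ hsNormSq a := by
  rw [hsNormSq_eq_sum]; positivity

theorem hsNormSq_frame {p : ℕ} (M : Matrix (Fin p) (Fin p) ℝ) (U : Orth p) :
    hsNormSq (frame M U) = hsNormSq M := by
  have h := mul_transpose_self_coe U
  simp only [hsNormSq, frame, Matrix.transpose_mul, Matrix.transpose_transpose]
  rw [Matrix.trace_mul_comm]
  have : (U : Matrix (Fin p) (Fin p) ℝ).transpose * M * (U : Matrix (Fin p) (Fin p) ℝ) *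
      ((U : Matrix (Fin p) (Fin p) ℝ).transpose * (M.transpose * (U : Matrix (Fin p) (Fin p) ℝ))) =
      (U : Matrix (Fin p) (Fin p) ℝ).transpose * (M * ((U : Matrix (Fin p) (Fin p) ℝ) *
      (U : Matrix (Fin p) (Fin p) ℝ).transpose) * M.transpose * (U : Matrix (Fin p) (Fin p) ℝ)) := by
    simp only [Matrix.mul_assoc]
  rw [this, h, Matrix.trace_mul_comm, Matrix.mul_one, Matrix.mul_assoc, Matrix.mul_assoc, h,
    Matrix.mul_one, Matrix.trace_mul_comm]

/-- In the moving frame the target is constant, so `U` enters the loss only through `frame M U`. -/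
theorem hsNormSq_sub_projLE {p : ℕ} (d : ℕ) (M : Matrix (Fin p) (Fin p) ℝ) (U : Orth p) :
    hsNormSq (M - projLE d U) = ∑ a, ∑ b, (frame M U a b -
      Matrix.diagonal (fun a : Fin p => if a.val < d then (1 : ℝ) else 0) a b) ^ 2 := by
  rw [← hsNormSq_frame _ U, hsNormSq_eq_sum, ← frame_projLE d U]
  simp [frame, Matrix.mul_sub, Matrix.sub_mul]

theorem sum_low_add_sum_high {p : ℕ} (d : ℕ) (f : Fin p → ℝ) :
    ∑ i : Low p d, f i + ∑ j : High p d, f j = ∑ a, f a := by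
  rw [← Fintype.sum_subtype_add_sum_subtype (fun a : Fin p => a.val < d) f]
  congr 1
  exact Fintype.sum_equiv (Equiv.subtypeEquivRight fun a => by simp) _ _ fun _ => rfl

theorem low_ne_high {p d : ℕ} (i : Low p d) (j : High p d) : i.1 ≠ j.1 := fun h =>
  absurd i.2 (not_lt.mpr (h ▸ j.2))

/-- The contribution of the score and of the derivative of the test field to the lower bound. -/
def penalty {p d : ℕ} (c s : Low p d → High p d → ℝ) : ℝ :=
  2 * ∑ i, ∑ j, c i j ^ 2 * s i j ^ 2 + 4 * ∑ i, (∑ j, c i j) ^ 2 + 4 * ∑ j, (∑ i, c i j) ^ 2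

/-- Completing squares: the entries `A i j` and `A j i` are shifted by `θ c s`, the entries `A i i -
1` by `2 θ` times a row sum, and the entries `A j j` by `-2 θ` times a column sum. The leftover
constants are the three sums of `penalty`. -/
theorem four_mul_sum_le_sum_sq_add_penalty {p d : ℕ} (A : Matrix (Fin p) (Fin p) ℝ)
    (c s : Low p d → High p d → ℝ) (θ : ℝ) :
    4 * θ * ∑ i, ∑ j, c i j - 2 * θ * ∑ i, ∑ j, c i j *
        (s i j * (A i.1 j.1 + A j.1 i.1) + 2 * (A i.1 i.1 - A j.1 j.1)) ≤
      ∑ a, ∑ b, (A a b -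
        Matrix.diagonal (fun a : Fin p => if a.val < d then (1 : ℝ) else 0) a b) ^ 2 +
      θ ^ 2 * penalty c s := by
  set E := Matrix.diagonal (fun a : Fin p => if a.val < d then (1 : ℝ) else 0) with hE
  have hsplit : ∑ a, ∑ b, (A a b - E a b) ^ 2 =
      (∑ i : Low p d, ((∑ i' : Low p d, (A i i' - E i i') ^ 2) +
        ∑ j : High p d, (A i j - E i j) ^ 2)) +
      ∑ j : High p d, ((∑ i : Low p d, (A j i - E j i) ^ 2) +
        ∑ j' : High p d, (A j j' - E j j') ^ 2) := by
    simp only [← sum_low_add_sum_high d]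
  -- Within the two diagonal blocks only the diagonal entries are kept; the other squares are
  -- dropped.
  have hlow : ∀ i : Low p d, (A i i - 1) ^ 2 ≤ ∑ i' : Low p d, (A i i' - E i i') ^ 2 := by
    intro i
    have h := Finset.single_le_sum (f := fun i' : Low p d => (A i i' - E i i') ^ 2)
      (fun _ _ => sq_nonneg _) (Finset.mem_univ i)
    simpa [hE, i.2] using h
  have hhigh : ∀ j : High p d, (A j j) ^ 2 ≤ ∑ j' : High p d, (A j j' - E j j') ^ 2 := by
    intro j
    have h := Finset.single_le_sum (f := fun j' : High p d => (A j j' - E j j') ^ 2)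
      (fun _ _ => sq_nonneg _) (Finset.mem_univ j)
    simpa [hE, not_lt.mpr j.2] using h
  have hlh : ∀ (i : Low p d) (j : High p d), E i j = 0 := fun i j =>
    Matrix.diagonal_apply_ne _ (low_ne_high i j)
  have hhl : ∀ (i : Low p d) (j : High p d), E j i = 0 := fun i j =>
    Matrix.diagonal_apply_ne _ (low_ne_high i j).symm
  have h1 : ∑ i, ∑ j, c i j = ∑ i, (∑ j, c i j) * 1 := by simp
  have h2 : ∑ i, ∑ j, c i j * (s i j * (A i.1 j.1 + A j.1 i.1) + 2 * (A i.1 i.1 - A j.1 j.1)) =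
      ∑ i, ∑ j, c i j * s i j * (A i.1 j.1 + A j.1 i.1) + 2 * ∑ i, (∑ j, c i j) * A i.1 i.1 -
        2 * ∑ j, (∑ i, c i j) * A j.1 j.1 := by
    have h3 : ∑ j, (∑ i, c i j) * A j.1 j.1 = ∑ i, ∑ j, c i j * A j.1 j.1 := by
      rw [Finset.sum_comm]; simp only [Finset.sum_mul]
    rw [h3]
    simp only [Finset.sum_mul, Finset.mul_sum, ← Finset.sum_add_distrib, ← Finset.sum_sub_distrib]
    exact Finset.sum_congr rfl fun i _ => Finset.sum_congr rfl fun j _ => by ring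
  have hcross : 0 ≤ ∑ i : Low p d, ∑ j : High p d,
      ((A i j ^ 2 + A j i ^ 2) + 2 * θ * (c i j * s i j * (A i.1 j.1 + A j.1 i.1)) +
        2 * θ ^ 2 * (c i j ^ 2 * s i j ^ 2)) :=
    Finset.sum_nonneg fun i _ => Finset.sum_nonneg fun j _ => by
      nlinarith [sq_nonneg (A i j + θ * (c i j * s i j)), sq_nonneg (A j i + θ * (c i j * s i j))]
  have hrow : 0 ≤ ∑ i : Low p d, ((A i i - 1) ^ 2 + 4 * θ * ((∑ j, c i j) * A i.1 i.1) -
      4 * θ * (∑ j, c i j) + 4 * θ ^ 2 * (∑ j, c i j) ^ 2) :=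
    Finset.sum_nonneg fun i _ => by
      nlinarith [sq_nonneg (A i i - 1 + 2 * θ * ∑ j, c i j)]
  have hcol : 0 ≤ ∑ j : High p d, ((A j j) ^ 2 - 4 * θ * ((∑ i, c i j) * A j.1 j.1) +
      4 * θ ^ 2 * (∑ i, c i j) ^ 2) :=
    Finset.sum_nonneg fun j _ => by
      nlinarith [sq_nonneg (A j j - 2 * θ * ∑ i, c i j)]
  have hl := Finset.sum_le_sum fun i (_ : i ∈ Finset.univ) => hlow i
  have hh := Finset.sum_le_sum fun i (_ : i ∈ Finset.univ) => hhigh i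
  have hswap : ∑ j : High p d, ∑ i : Low p d, A j i ^ 2 =
      ∑ i : Low p d, ∑ j : High p d, A j i ^ 2 := Finset.sum_comm
  rw [hsplit, h2, penalty]
  simp only [hlh, hhl, sub_zero, Finset.sum_add_distrib, Finset.sum_sub_distrib, hswap,
    ← Finset.mul_sum] at *
  linarith

/-! ### The density of the Gaussian model -/

/-- A finite product of measures with densities has the product density. -/
theorem pi_withDensity_ofReal {ι : Type*} [Fintype ι] {α : ι → Type*}
    [∀ i, MeasurableSpace (α i)] (μ : ∀ i, Measure (α i)) [∀ i, SigmaFinite (μ i)]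
    {f : ∀ i, α i → ℝ} (hf : ∀ i, Integrable (f i) (μ i)) (hf0 : ∀ i x, 0 ≤ f i x) :
    Measure.pi (fun i => (μ i).withDensity fun x => ENNReal.ofReal (f i x)) =
      (Measure.pi μ).withDensity fun x => ENNReal.ofReal (∏ i, f i (x i)) := by
  have hσ : ∀ i, SigmaFinite ((μ i).withDensity fun x => ENNReal.ofReal (f i x)) :=
    fun i => SigmaFinite.withDensity_ofReal (f i)
  refine Measure.pi_eq fun s hs => ?_
  have hint : ∀ i, Integrable ((s i).indicator (f i)) (μ i) := fun i => (hf i).indicator (hs i)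
  have hnn : ∀ i x, 0 ≤ (s i).indicator (f i) x :=
    fun i x => Set.indicator_nonneg (fun y _ => hf0 i y) x
  have hone : ∀ i, ((μ i).withDensity fun x => ENNReal.ofReal (f i x)) (s i) =
      ENNReal.ofReal (∫ x, (s i).indicator (f i) x ∂(μ i)) := by
    intro i
    rw [ofReal_integral_eq_lintegral_ofReal (hint i) (Filter.Eventually.of_forall (hnn i)),
      withDensity_apply _ (hs i), ← lintegral_indicator (hs i)]
    refine lintegral_congr fun x => ?_
    by_cases hx : x ∈ s i <;> simp [hx]
  have hprod : ∀ x : ∀ i, α i, (Set.univ.pi s).indicator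
      (fun x => ENNReal.ofReal (∏ i, f i (x i))) x =
      ENNReal.ofReal (∏ i, (s i).indicator (f i) (x i)) := by
    intro x
    by_cases hx : x ∈ Set.univ.pi s
    · rw [Set.indicator_of_mem hx]
      congr 1
      exact Finset.prod_congr rfl fun i _ => (Set.indicator_of_mem (hx i (Set.mem_univ i)) _).symm
    · rw [Set.indicator_of_notMem hx]
      simp only [Set.mem_pi, Set.mem_univ, true_implies, not_forall] at hx
      obtain ⟨i, hi⟩ := hx
      rw [Finset.prod_eq_zero (Finset.mem_univ i) (Set.indicator_of_notMem hi _),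
        ENNReal.ofReal_zero]
  rw [withDensity_apply _ (MeasurableSet.univ_pi hs),
    ← lintegral_indicator (MeasurableSet.univ_pi hs)]
  simp only [hprod, hone]
  -- Passing to Bochner integrals allows the Fubini formula for finite products of real functions.
  rw [← ofReal_integral_eq_lintegral_ofReal (Integrable.fintype_prod_dep hint)
    (Filter.Eventually.of_forall fun x => Finset.prod_nonneg fun i _ => hnn i _),
    integral_fintype_prod_eq_prod (fun i x => (s i).indicator (f i) x)]
  exact ENNReal.ofReal_prod_of_nonneg fun i _ => integral_nonneg (hnn i)

theorem map_withDensity_comp_of_measurePreserving {α β : Type*} [MeasurableSpace α]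
    [MeasurableSpace β] {μ : Measure α} {ν : Measure β} {g : α → β} (hg : MeasurePreserving g μ ν)
    {f : β → ℝ≥0∞} (hf : Measurable f) :
    (μ.withDensity fun a => f (g a)).map g = ν.withDensity f := by
  ext s hs
  rw [Measure.map_apply hg.measurable hs, withDensity_apply _ (hg.measurable hs),
    withDensity_apply _ hs, hg.setLIntegral_comp_preimage hs hf]

/-- The isometry `x ↦ U x`. -/
def isometryOrth {p : ℕ} (U : Orth p) : EuclideanSpace ℝ (Fin p) ≃ₗᵢ[ℝ] EuclideanSpace ℝ (Fin p) :=
  Unitary.linearIsometryEquiv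
    ⟨Matrix.toEuclideanCLM (𝕜 := ℝ) (U : Matrix (Fin p) (Fin p) ℝ), Unitary.map_mem _ U.2⟩

theorem isometryOrth_apply {p : ℕ} (U : Orth p) (x : EuclideanSpace ℝ (Fin p)) (b : Fin p) :
    isometryOrth U x b = ∑ a, (U : Matrix (Fin p) (Fin p) ℝ) b a * x a := by
  have h := congrFun (Matrix.ofLp_toEuclideanCLM (𝕜 := ℝ) (U : Matrix (Fin p) (Fin p) ℝ) x) b
  exact h

theorem coord_isometryOrth {p : ℕ} (U : Orth p) (x : EuclideanSpace ℝ (Fin p)) (a : Fin p) :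
    coord U (isometryOrth U x) a = x a := by
  have h : ∀ c, ∑ b, (U : Matrix (Fin p) (Fin p) ℝ) b a * (U : Matrix (Fin p) (Fin p) ℝ) b c =
      if a = c then 1 else 0 := by
    intro c
    have := congrFun (congrFun (transpose_mul_self_coe U) a) c
    rwa [Matrix.mul_apply, Matrix.one_apply] at this
  simp only [coord, isometryOrth_apply, Finset.sum_mul]
  rw [Finset.sum_comm]
  have h2 : ∀ c, ∑ b, (U : Matrix (Fin p) (Fin p) ℝ) b c * x c *
      (U : Matrix (Fin p) (Fin p) ℝ) b a = (if a = c then 1 else 0) * x c := by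
    intro c
    rw [← h c, Finset.sum_mul]
    exact Finset.sum_congr rfl fun b _ => by ring
  simp [h2]

theorem isometryOrth_symm_apply {p : ℕ} (U : Orth p) (x : EuclideanSpace ℝ (Fin p)) (a : Fin p) :
    (isometryOrth U).symm x a = coord U x a := by
  rw [← coord_isometryOrth U ((isometryOrth U).symm x) a, LinearIsometryEquiv.apply_symm_apply]

theorem posSemidef_covMatrix {p : ℕ} {lam : Fin p → ℝ} (hpos : ∀ i, 0 < lam i) (U : Orth p) :
    (covMatrix lam U).PosSemidef := by
  have h := (Matrix.PosSemidef.diagonal (d := lam) fun i => (hpos i).le).mul_mul_conjTranspose_same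
    (U : Matrix (Fin p) (Fin p) ℝ)
  rwa [Matrix.conjTranspose_eq_transpose_of_trivial] at h

theorem dotProduct_covMatrix_mulVec {p : ℕ} (lam : Fin p → ℝ) (U : Orth p)
    (x : EuclideanSpace ℝ (Fin p)) :
    x.ofLp ⬝ᵥ (covMatrix lam U).mulVec x.ofLp = ∑ a, lam a * coord U x a ^ 2 := by
  have h : Matrix.vecMul x.ofLp (U : Matrix (Fin p) (Fin p) ℝ) = coord U x := by
    ext a; simp [Matrix.vecMul, dotProduct, coord]
  rw [covMatrix, Matrix.dotProduct_mulVec, ← Matrix.vecMul_vecMul, ← Matrix.vecMul_vecMul, h,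
    ← Matrix.dotProduct_mulVec, Matrix.mulVec_transpose, h]
  simp only [dotProduct, Matrix.vecMul_diagonal]
  exact Finset.sum_congr rfl fun a _ => by ring

/-- Both characteristic functions at `t` are `exp (-∑ λ_a (Uᵀ t)_a² / 2)`: the quadratic form of `U
Λ Uᵀ` is diagonal in the coordinates `Uᵀ t`. -/
theorem multivariateGaussian_covMatrix_eq_map {p : ℕ} {lam : Fin p → ℝ} (hpos : ∀ i, 0 < lam i)
    (U : Orth p) :
    multivariateGaussian 0 (covMatrix lam U) =
      ((Measure.pi fun a => gaussianReal 0 (lam a).toNNReal).map (WithLp.toLp 2)).map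
        (isometryOrth U) := by
  have : IsProbabilityMeasure
      ((Measure.pi fun a => gaussianReal 0 (lam a).toNNReal).map (WithLp.toLp 2)) :=
    Measure.isProbabilityMeasure_map (by fun_prop)
  have : IsProbabilityMeasure
      (((Measure.pi fun a => gaussianReal 0 (lam a).toNNReal).map (WithLp.toLp 2)).map
        (isometryOrth U)) :=
    Measure.isProbabilityMeasure_map (isometryOrth U).continuous.measurable.aemeasurable
  refine Measure.ext_of_charFun ?_
  ext t
  have hmap : charFun (((Measure.pi fun a => gaussianReal 0 (lam a).toNNReal).map
      (WithLp.toLp 2)).map (isometryOrth U)) t =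
      charFun ((Measure.pi fun a => gaussianReal 0 (lam a).toNNReal).map (WithLp.toLp 2))
        ((isometryOrth U).symm t) := by
    rw [charFun_apply, charFun_apply,
      integral_map (isometryOrth U).continuous.measurable.aemeasurable (by fun_prop)]
    simp only [LinearIsometryEquiv.inner_map_eq_flip]
  rw [hmap, charFun_multivariateGaussian (posSemidef_covMatrix hpos U), charFun_pi,
    dotProduct_covMatrix_mulVec]
  simp only [charFun_gaussianReal, ← Complex.exp_sum, isometryOrth_symm_apply]
  congr 1
  simp [Finset.sum_neg_distrib, Finset.sum_div, Real.coe_toNNReal _ (hpos _).le]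

/-- The density of `N(0, U Λ Uᵀ)`. -/
theorem multivariateGaussian_covMatrix_eq_withDensity {p : ℕ} {lam : Fin p → ℝ}
    (hpos : ∀ i, 0 < lam i) (U : Orth p) :
    multivariateGaussian 0 (covMatrix lam U) =
      (volume : Measure (EuclideanSpace ℝ (Fin p))).withDensity fun x =>
        ENNReal.ofReal (∏ a, gaussianPDFReal 0 (lam a).toNNReal (coord U x a)) := by
  have hv : ∀ a, (lam a).toNNReal ≠ 0 := fun a => (Real.toNNReal_pos.mpr (hpos a)).ne'
  have hpi : (Measure.pi fun a => gaussianReal 0 (lam a).toNNReal) =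
      (volume : Measure (Fin p → ℝ)).withDensity fun z =>
        ENNReal.ofReal (∏ a, gaussianPDFReal 0 (lam a).toNNReal (z a)) := by
    simp only [gaussianReal_of_var_ne_zero _ (hv _), gaussianPDF_def]
    exact pi_withDensity_ofReal _ (fun a => integrable_gaussianPDFReal _ _)
      (fun a x => gaussianPDFReal_nonneg _ _ _)
  have hmp : MeasurePreserving (fun z : Fin p → ℝ => isometryOrth U (WithLp.toLp 2 z)) :=
    (isometryOrth U).measurePreserving.comp (PiLp.volume_preserving_toLp (Fin p))
  have hmeas : Measurable fun x : EuclideanSpace ℝ (Fin p) =>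
      ENNReal.ofReal (∏ a, gaussianPDFReal 0 (lam a).toNNReal (coord U x a)) := by
    refine ENNReal.measurable_ofReal.comp (Finset.measurable_prod _ fun a _ => ?_)
    refine (measurable_gaussianPDFReal _ _).comp ?_
    unfold coord
    fun_prop
  rw [multivariateGaussian_covMatrix_eq_map hpos,
    Measure.map_map (isometryOrth U).continuous.measurable (by fun_prop), hpi,
    ← map_withDensity_comp_of_measurePreserving hmp hmeas]
  simp only [coord_isometryOrth]
  rfl

/-- The normalizing constant of the density of `P_U`. -/
def normConst {p : ℕ} (n : ℕ) (lam : Fin p → ℝ) : ℝ :=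
  ∏ _k : Fin n, ∏ a, (√(2 * Real.pi * lam a))⁻¹

/-- The density of `P_U`. -/
def dens {p n : ℕ} (lam : Fin p → ℝ) (U : Orth p) (X : Sample p n) : ℝ :=
  normConst n lam * Real.exp (-quad lam U X)

theorem normConst_nonneg {p n : ℕ} (lam : Fin p → ℝ) : 0 ≤ normConst n lam :=
  Finset.prod_nonneg fun _ _ => Finset.prod_nonneg fun _ _ => by positivity

theorem dens_nonneg {p n : ℕ} (lam : Fin p → ℝ) (U : Orth p) (X : Sample p n) :
    0 ≤ dens lam U X :=
  mul_nonneg (normConst_nonneg lam) (Real.exp_pos _).le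

theorem model_eq_withDensity {p n : ℕ} {lam : Fin p → ℝ} (hpos : ∀ i, 0 < lam i) (U : Orth p) :
    model n lam U =
      (volume : Measure (Sample p n)).withDensity fun X => ENNReal.ofReal (dens lam U X) := by
  have hnn : ∀ x : EuclideanSpace ℝ (Fin p),
      0 ≤ ∏ a, gaussianPDFReal 0 (lam a).toNNReal (coord U x a) :=
    fun x => Finset.prod_nonneg fun a _ => gaussianPDFReal_nonneg _ _ _
  have hmeas : Measurable fun x : EuclideanSpace ℝ (Fin p) =>
      ∏ a, gaussianPDFReal 0 (lam a).toNNReal (coord U x a) := by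
    refine Finset.measurable_prod _ fun a _ => ?_
    refine (measurable_gaussianPDFReal _ _).comp ?_
    unfold coord
    fun_prop
  have hint : Integrable (fun x : EuclideanSpace ℝ (Fin p) =>
      ∏ a, gaussianPDFReal 0 (lam a).toNNReal (coord U x a)) := by
    -- Integrability of the density is read off from the total mass one of the Gaussian measure.
    refine ⟨hmeas.aestronglyMeasurable, ?_⟩
    rw [hasFiniteIntegral_iff_ofReal (Filter.Eventually.of_forall hnn)]
    have h : multivariateGaussian 0 (covMatrix lam U) Set.univ = 1 := measure_univ
    rw [multivariateGaussian_covMatrix_eq_withDensity hpos, withDensity_apply _ MeasurableSet.univ,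
      Measure.restrict_univ] at h
    rw [h]
    exact ENNReal.one_lt_top
  unfold model
  simp only [multivariateGaussian_covMatrix_eq_withDensity hpos]
  rw [pi_withDensity_ofReal _ (fun _ => hint) (fun _ => hnn)]
  refine congrArg _ (funext fun X => congrArg _ ?_)
  rw [dens, normConst, quad, ← Finset.sum_neg_distrib, Real.exp_sum, ← Finset.prod_mul_distrib]
  refine Finset.prod_congr rfl fun k _ => ?_
  rw [← Finset.sum_neg_distrib, Real.exp_sum, ← Finset.prod_mul_distrib]
  refine Finset.prod_congr rfl fun a _ => ?_
  simp only [gaussianPDFReal_def, Real.coe_toNNReal _ (hpos a).le, sub_zero, neg_div]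

/-! ### The Fisher information -/

/-- Writing the monomial as a product over all coordinates, with factor one off `{i, j}`, brings it
into the form required by Fubini for product measures. -/
theorem prod_ite_pair {p : ℕ} {i j : Fin p} (hij : i ≠ j) (m : ℕ) (z : Fin p → ℝ) :
    ∏ a, (if a ∈ ({i, j} : Finset (Fin p)) then z a ^ m else 1) = (z i * z j) ^ m := by
  rw [Fintype.prod_ite_mem, Finset.prod_pair hij, mul_pow]

theorem integrable_pow_gaussianReal (v : NNReal) (m : ℕ) :
    Integrable (fun x : ℝ => x ^ m) (gaussianReal 0 v) :=
  ((memLp_id_gaussianReal (μ := 0) (v := v) (m : NNReal)).integrable_norm_pow').mono'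
    (by fun_prop) (Filter.Eventually.of_forall fun x => by simp)

theorem integrable_mul_pow_pi_gaussianReal {p : ℕ} (v : Fin p → NNReal) {i j : Fin p} (hij : i ≠ j)
    (m : ℕ) :
    Integrable (fun z : Fin p → ℝ => (z i * z j) ^ m)
      (Measure.pi fun a => gaussianReal 0 (v a)) := by
  simp only [← prod_ite_pair hij m]
  refine Integrable.fintype_prod
    (f := fun a x => if a ∈ ({i, j} : Finset (Fin p)) then x ^ m else 1)
    fun a => ?_
  split_ifs
  · exact integrable_pow_gaussianReal _ _
  · exact integrable_const _

theorem integral_mul_pow_pi_gaussianReal {p : ℕ} (v : Fin p → NNReal) {i j : Fin p} (hij : i ≠ j)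
    (m : ℕ) :
    ∫ z : Fin p → ℝ, (z i * z j) ^ m ∂(Measure.pi fun a => gaussianReal 0 (v a)) =
      (∫ x, x ^ m ∂(gaussianReal 0 (v i))) * ∫ x, x ^ m ∂(gaussianReal 0 (v j)) := by
  simp only [← prod_ite_pair hij m]
  rw [integral_fintype_prod_eq_prod
    (fun a x => if a ∈ ({i, j} : Finset (Fin p)) then x ^ m else (1 : ℝ))]
  have h : ∀ a, ∫ x, (if a ∈ ({i, j} : Finset (Fin p)) then x ^ m else (1 : ℝ))
      ∂(gaussianReal 0 (v a)) = if a ∈ ({i, j} : Finset (Fin p)) then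
        ∫ x, x ^ m ∂(gaussianReal 0 (v a)) else 1 := by
    intro a
    split_ifs <;> simp
  simp only [h]
  rw [Fintype.prod_ite_mem, Finset.prod_pair hij]

theorem integral_sq_gaussianReal (v : NNReal) : ∫ x, x ^ 2 ∂(gaussianReal 0 v) = v := by
  have h := variance_of_integral_eq_zero (X := id) (μ := gaussianReal 0 v)
    aemeasurable_id (by simp)
  rw [variance_id_gaussianReal] at h
  exact h.symm

/-- Combined with `coord_isometryOrth`, this says that the coordinates in the frame of `U` are
independent centred Gaussians with variances `lam a`. -/
theorem measurePreserving_coord {p : ℕ} {lam : Fin p → ℝ} (hpos : ∀ i, 0 < lam i) (U : Orth p) :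
    MeasurePreserving (fun z : Fin p → ℝ => isometryOrth U (WithLp.toLp 2 z))
      (Measure.pi fun a => gaussianReal 0 (lam a).toNNReal)
      (multivariateGaussian 0 (covMatrix lam U)) := by
  have hm : Measurable fun z : Fin p → ℝ => isometryOrth U (WithLp.toLp 2 z) :=
    (isometryOrth U).continuous.measurable.comp (by fun_prop)
  refine ⟨hm, ?_⟩
  rw [multivariateGaussian_covMatrix_eq_map hpos,
    Measure.map_map (isometryOrth U).continuous.measurable (by fun_prop)]
  rfl

theorem measurable_coord_mul_coord {p : ℕ} (U : Orth p) (i j : Fin p) :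
    Measurable fun x : EuclideanSpace ℝ (Fin p) => coord U x i * coord U x j := by
  unfold coord
  fun_prop

theorem integral_coord_mul_coord_pow {p : ℕ} {lam : Fin p → ℝ} (hpos : ∀ i, 0 < lam i)
    (U : Orth p) {i j : Fin p} (hij : i ≠ j) (m : ℕ) :
    ∫ x, (coord U x i * coord U x j) ^ m ∂(multivariateGaussian 0 (covMatrix lam U)) =
      (∫ x, x ^ m ∂(gaussianReal 0 (lam i).toNNReal)) *
        ∫ x, x ^ m ∂(gaussianReal 0 (lam j).toNNReal) := by
  rw [← (measurePreserving_coord hpos U).map_eq,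
    integral_map (measurePreserving_coord hpos U).measurable.aemeasurable
      ((measurable_coord_mul_coord U i j).pow_const m).aestronglyMeasurable]
  simp only [coord_isometryOrth]
  exact integral_mul_pow_pi_gaussianReal (fun a => (lam a).toNNReal) hij m

theorem memLp_coord_mul_coord {p : ℕ} {lam : Fin p → ℝ} (hpos : ∀ i, 0 < lam i)
    (U : Orth p) {i j : Fin p} (hij : i ≠ j) :
    MemLp (fun x => coord U x i * coord U x j) 2 (multivariateGaussian 0 (covMatrix lam U)) := by
  have hm := measurable_coord_mul_coord U i j
  rw [memLp_two_iff_integrable_sq hm.aestronglyMeasurable,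
    ← (measurePreserving_coord hpos U).map_eq,
    integrable_map_measure (hm.pow_const 2).aestronglyMeasurable
      (measurePreserving_coord hpos U).measurable.aemeasurable]
  simp only [Function.comp_def, coord_isometryOrth]
  exact integrable_mul_pow_pi_gaussianReal (fun a => (lam a).toNNReal) hij 2

/-- The Fisher information of the model in the direction of a plane rotation. -/
theorem integrable_score_sq_and_integral_eq {p n : ℕ} {lam : Fin p → ℝ}
    (hpos : ∀ i, 0 < lam i) (U : Orth p) {i j : Fin p} (hij : i ≠ j) :
    Integrable (fun X => score lam i j U X ^ 2) (model n lam U) ∧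
      ∫ X, score lam i j U X ^ 2 ∂(model n lam U) =
        n * ((lam i - lam j) ^ 2 / (lam i * lam j)) := by
  let W : EuclideanSpace ℝ (Fin p) → ℝ := fun x => coord U x i * coord U x j
  have hWL := memLp_coord_mul_coord hpos U hij
  have hmean : ∫ x, W x ∂(multivariateGaussian 0 (covMatrix lam U)) = 0 := by
    have h := integral_coord_mul_coord_pow hpos U hij 1
    simpa using h
  -- The second moment of a product of two independent centred variables is the product of their
  -- variances.
  have hvar1 : Var[W; multivariateGaussian 0 (covMatrix lam U)] = lam i * lam j := by
    rw [variance_of_integral_eq_zero hWL.aemeasurable hmean]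
    refine (integral_coord_mul_coord_pow hpos U hij 2).trans ?_
    rw [integral_sq_gaussianReal,
      integral_sq_gaussianReal, Real.coe_toNNReal _ (hpos i).le, Real.coe_toNNReal _ (hpos j).le]
  have hL : ∀ k : Fin n, MemLp (fun X : Sample p n => W (X k)) 2 (model n lam U) := fun k =>
    hWL.comp_measurePreserving
      (measurePreserving_eval (fun _ : Fin n => multivariateGaussian 0 (covMatrix lam U)) k)
  have hsumL : MemLp (∑ k : Fin n, fun X : Sample p n => W (X k)) 2 (model n lam U) :=
    memLp_finsetSum' _ fun k _ => hL k
  have hprob : IsProbabilityMeasure (model n lam U) := by unfold model; infer_instance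
  have hsummean : ∫ X, (∑ k : Fin n, fun X : Sample p n => W (X k)) X ∂(model n lam U) = 0 := by
    simp only [Finset.sum_apply]
    rw [integral_finsetSum _ fun k _ => (hL k).integrable (by norm_num)]
    refine Finset.sum_eq_zero fun k _ => ?_
    exact (integral_comp_eval
      (μ := fun _ : Fin n => multivariateGaussian 0 (covMatrix lam U)) (i := k)
      hWL.aestronglyMeasurable).trans hmean
  have hvar : ∫ X, (∑ k : Fin n, fun X : Sample p n => W (X k)) X ^ 2 ∂(model n lam U) =
      n * (lam i * lam j) := by
    rw [← variance_of_integral_eq_zero hsumL.aemeasurable hsummean]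
    have h := variance_sum_pi (μ := fun _ : Fin n => multivariateGaussian 0 (covMatrix lam U))
      (X := fun _ => W) fun _ => hWL
    rw [model, h]
    simp [hvar1]
  have hscore : ∀ X : Sample p n, score lam i j U X ^ 2 = (1 / lam i - 1 / lam j) ^ 2 *
      (∑ k : Fin n, fun X : Sample p n => W (X k)) X ^ 2 := by
    intro X
    simp only [score, mul_pow, Finset.sum_apply, W]
  simp only [hscore]
  refine ⟨hsumL.integrable_sq.const_mul _, ?_⟩
  rw [integral_const_mul, hvar]
  have hi := (hpos i).ne'
  have hj := (hpos j).ne'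
  field_simp
  ring

/-! ### The lower bound for the Bayes risk -/

theorem continuous_dens {p n : ℕ} (lam : Fin p → ℝ) :
    Continuous fun z : Orth p × Sample p n => dens lam z.1 z.2 := by
  unfold dens
  exact continuous_const.mul (Real.continuous_exp.comp (continuous_quad lam).neg)

theorem continuous_dens_left {p n : ℕ} (lam : Fin p → ℝ) (X : Sample p n) :
    Continuous fun U : Orth p => dens lam U X := by
  unfold dens
  exact continuous_const.mul (Real.continuous_exp.comp (continuous_quad_left lam X).neg)

/-- Exchanging the sample and the Haar integrals. -/
theorem lintegral_haarOrth_lintegral_model {p n : ℕ} {lam : Fin p → ℝ} (hpos : ∀ i, 0 < lam i)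
    {F : Orth p × Sample p n → ℝ} (hF : Measurable F) :
    ∫⁻ U, ∫⁻ X, ENNReal.ofReal (F (U, X)) ∂(model n lam U) ∂(haarOrth p) =
      ∫⁻ X, ∫⁻ U, ENNReal.ofReal (dens lam U X * F (U, X)) ∂(haarOrth p) := by
  have hD : Measurable fun z : Orth p × Sample p n => dens lam z.1 z.2 :=
    (continuous_dens lam).measurable
  have h : ∀ U, ∫⁻ X, ENNReal.ofReal (F (U, X)) ∂(model n lam U) =
      ∫⁻ X, ENNReal.ofReal (dens lam U X * F (U, X)) := by
    intro U
    rw [model_eq_withDensity hpos, lintegral_withDensity_eq_lintegral_mul]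
    · simp only [Pi.mul_apply, ENNReal.ofReal_mul (dens_nonneg lam U _)]
    · exact (hD.comp measurable_prodMk_left).ennreal_ofReal
    · exact (hF.comp measurable_prodMk_left).ennreal_ofReal
  simp only [h]
  exact lintegral_lintegral_swap (hD.mul hF).ennreal_ofReal.aemeasurable

/-- The information bound for a fixed sample. -/
theorem lintegral_dens_le {p n d : ℕ} {lam : Fin p → ℝ} (c : Low p d → High p d → ℝ) {θ : ℝ}
    (X : Sample p n) (M : Matrix (Fin p) (Fin p) ℝ) :
    ∫⁻ U, ENNReal.ofReal (dens lam U X * (4 * θ * ∑ i, ∑ j, c i j)) ∂(haarOrth p) ≤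
      ∫⁻ U, ENNReal.ofReal (dens lam U X * hsNormSq (M - projLE d U)) ∂(haarOrth p) +
      ∫⁻ U, ENNReal.ofReal (dens lam U X *
        (θ ^ 2 * penalty c fun i j => score lam i.1 j.1 U X)) ∂(haarOrth p) := by
  have hD := continuous_dens_left lam X
  have hs : ∀ i j, Continuous fun U : Orth p => score lam i j U X :=
    fun i j => continuous_score_left lam i j X
  have hm : ∀ a b, Continuous fun U : Orth p => frame M U a b :=
    fun a b => (continuous_frame M).matrix_elem a b
  have hN : Continuous fun U : Orth p => hsNormSq (M - projLE d U) := by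
    simp only [hsNormSq_sub_projLE]
    exact continuous_finsetSum _ fun a _ => continuous_finsetSum _ fun b _ =>
      ((hm a b).sub continuous_const).pow 2
  have hW : Continuous fun U : Orth p => penalty c fun i j => score lam i.1 j.1 U X := by
    unfold penalty
    refine ((continuous_const.mul (continuous_finsetSum _ fun i _ =>
      continuous_finsetSum _ fun j _ => ?_)).add continuous_const).add continuous_const
    exact continuous_const.mul ((hs i.1 j.1).pow 2)
  have hW0 : ∀ U : Orth p, 0 ≤ penalty c fun i j => score lam i.1 j.1 U X := by
    intro U; unfold penalty; positivity
  have iN : Integrable (fun U => dens lam U X * hsNormSq (M - projLE d U)) (haarOrth p) :=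
    integrable_haarOrth_of_continuous (hD.mul hN)
  have iW : Integrable (fun U => dens lam U X *
      (θ ^ 2 * penalty c fun i j => score lam i.1 j.1 U X)) (haarOrth p) :=
    integrable_haarOrth_of_continuous (hD.mul (continuous_const (y := θ ^ 2) |>.mul hW))
  have iC : Integrable (fun U => dens lam U X * (4 * θ * ∑ i, ∑ j, c i j)) (haarOrth p) :=
    integrable_haarOrth_of_continuous (hD.mul (continuous_const (y := 4 * θ * ∑ i, ∑ j, c i j)))
  let T : Low p d → High p d → Orth p → ℝ := fun i j U =>
    score lam i.1 j.1 U X * (frame M U i.1 j.1 + frame M U j.1 i.1) +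
      2 * (frame M U i.1 i.1 - frame M U j.1 j.1)
  have cT : ∀ i j, Continuous (T i j) := fun i j =>
    ((hs i.1 j.1).mul ((hm _ _).add (hm _ _))).add (continuous_const.mul ((hm _ _).sub (hm _ _)))
  have iT : ∀ i j, Integrable (fun U => dens lam U X * T i j U) (haarOrth p) := fun i j =>
    integrable_haarOrth_of_continuous (hD.mul (cT i j))
  -- The normalizing constant does not depend on `U`, so the integration by parts for `exp (-quad)`
  -- carries over to the density.
  have zT : ∀ i j, ∫ U, dens lam U X * T i j U ∂(haarOrth p) = 0 := by
    intro i j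
    have h := integral_exp_neg_quad_mul_score (lam := lam) (low_ne_high i j) X M
    simp only [dens, mul_assoc, integral_const_mul]
    rw [h, mul_zero]
  have iS : Integrable (fun U => ∑ i, ∑ j, c i j * (dens lam U X * T i j U)) (haarOrth p) :=
    integrable_finsetSum _ fun i _ => integrable_finsetSum _ fun j _ => (iT i j).const_mul _
  have zS : ∫ U, ∑ i, ∑ j, c i j * (dens lam U X * T i j U) ∂(haarOrth p) = 0 := by
    rw [integral_finsetSum _ fun i _ => integrable_finsetSum _ fun j _ => (iT i j).const_mul _]
    refine Finset.sum_eq_zero fun i _ => ?_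
    rw [integral_finsetSum _ fun j _ => (iT i j).const_mul _]
    refine Finset.sum_eq_zero fun j _ => ?_
    rw [integral_const_mul, zT, mul_zero]
  have key : ∀ U : Orth p, dens lam U X * (4 * θ * ∑ i, ∑ j, c i j) -
      2 * θ * ∑ i, ∑ j, c i j * (dens lam U X * T i j U) ≤
      dens lam U X * hsNormSq (M - projLE d U) +
        dens lam U X * (θ ^ 2 * penalty c fun i j => score lam i.1 j.1 U X) := by
    intro U
    have h := mul_le_mul_of_nonneg_left (four_mul_sum_le_sum_sq_add_penalty (frame M U) c
      (fun i j => score lam i.1 j.1 U X) θ) (dens_nonneg lam U X)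
    rw [← hsNormSq_sub_projLE, mul_add] at h
    refine le_trans (le_of_eq ?_) h
    rw [mul_sub]
    congr 1
    simp only [Finset.mul_sum]
    exact Finset.sum_congr rfl fun i _ => Finset.sum_congr rfl fun j _ => by simp only [T]; ring
  have hle := integral_mono (iC.sub (iS.const_mul (2 * θ))) (iN.add iW) key
  simp only [Pi.add_apply, Pi.sub_apply] at hle
  rw [integral_sub iC (iS.const_mul (2 * θ)), integral_const_mul, zS, mul_zero, sub_zero,
    integral_add iN iW] at hle
  have nN : ∀ U : Orth p, 0 ≤ dens lam U X * hsNormSq (M - projLE d U) := fun U =>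
    mul_nonneg (dens_nonneg lam U X) (hsNormSq_nonneg _)
  have nW : ∀ U : Orth p,
      0 ≤ dens lam U X * (θ ^ 2 * penalty c fun i j => score lam i.1 j.1 U X) := fun U =>
    mul_nonneg (dens_nonneg lam U X) (mul_nonneg (sq_nonneg _) (hW0 U))
  rw [← ofReal_integral_eq_lintegral_ofReal iN (Filter.Eventually.of_forall nN),
    ← ofReal_integral_eq_lintegral_ofReal iW (Filter.Eventually.of_forall nW),
    ← ENNReal.ofReal_add (integral_nonneg nN) (integral_nonneg nW)]
  -- No sign is imposed on `θ` or `c` here; if the constant is nonpositive, `ENNReal.ofReal`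
  -- truncates the left-hand side to zero.
  rcases le_total 0 (4 * θ * ∑ i, ∑ j, c i j) with hC | hC
  · rw [← ofReal_integral_eq_lintegral_ofReal iC (Filter.Eventually.of_forall fun U =>
      mul_nonneg (dens_nonneg lam U X) hC)]
    exact ENNReal.ofReal_le_ofReal hle
  · simp [ENNReal.ofReal_of_nonpos (mul_nonpos_of_nonneg_of_nonpos (dens_nonneg lam _ X) hC)]

/-- The entry bound is two divided by the Fisher information in the direction `(i, j)`. For equal
eigenvalues the information is zero, so no entry bound is needed. -/
theorem sq_mul_information_le {p n d : ℕ} (hn : 1 ≤ n) {lam : Fin p → ℝ} (hpos : ∀ i, 0 < lam i)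
    {δ : ℝ} {c : Low p d → High p d → ℝ} (hc : Feasible n d lam δ c) (i : Low p d)
    (j : High p d) :
    c i j ^ 2 * (n * ((lam i.1 - lam j.1) ^ 2 / (lam i.1 * lam j.1))) ≤ 2 * c i j := by
  have hi := hpos i.1
  have hj := hpos j.1
  have hn' : (0 : ℝ) < n := by exact_mod_cast hn
  have h0 := hc.nonneg i j
  by_cases h : lam i.1 = lam j.1
  · simp [h, h0]
  · have hd : 0 < (lam i.1 - lam j.1) ^ 2 := by
      have := sub_ne_zero.mpr h
      positivity
    have hb := mul_le_mul_of_nonneg_right (hc.entry_le i j h)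
      (by positivity : 0 ≤ c i j * (n * ((lam i.1 - lam j.1) ^ 2 / (lam i.1 * lam j.1))))
    calc _ = c i j * (c i j * (n * ((lam i.1 - lam j.1) ^ 2 / (lam i.1 * lam j.1)))) := by ring
      _ ≤ _ := hb
      _ = 2 * c i j := by field_simp

/-- The expected penalty of a feasible matrix. -/
theorem lintegral_penalty_le {p n d : ℕ} (hn : 1 ≤ n) {lam : Fin p → ℝ} (hpos : ∀ i, 0 < lam i)
    {δ : ℝ} {c : Low p d → High p d → ℝ} (hc : Feasible n d lam δ c) (θ : ℝ) (U : Orth p) :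
    ∫⁻ X, ENNReal.ofReal (θ ^ 2 * penalty c fun i j => score lam i.1 j.1 U X) ∂(model n lam U) ≤
      ENNReal.ofReal (θ ^ 2 * (4 * (1 + 2 * δ) * ∑ i, ∑ j, c i j)) := by
  have hprob : IsProbabilityMeasure (model n lam U) := by unfold model; infer_instance
  have hI : ∀ (i : Low p d) (j : High p d), Integrable
      (fun X => c i j ^ 2 * score lam i.1 j.1 U X ^ 2) (model n lam U) := fun i j =>
    (integrable_score_sq_and_integral_eq hpos U (low_ne_high i j)).1.const_mul _
  have hI1 : Integrable (fun X => ∑ i : Low p d, ∑ j : High p d,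
      c i j ^ 2 * score lam i.1 j.1 U X ^ 2) (model n lam U) :=
    integrable_finsetSum _ fun i _ => integrable_finsetSum _ fun j _ => hI i j
  have hI2 := (hI1.const_mul 2).add (integrable_const (4 * ∑ i, (∑ j, c i j) ^ 2))
  have hI3 := hI2.add (integrable_const (4 * ∑ j, (∑ i, c i j) ^ 2))
  have hint : Integrable (fun X => penalty c fun i j => score lam i.1 j.1 U X) (model n lam U) :=
    hI3
  have hval : ∫ X, penalty c (fun i j => score lam i.1 j.1 U X) ∂(model n lam U) =
      2 * ∑ i, ∑ j, c i j ^ 2 * (n * ((lam i.1 - lam j.1) ^ 2 / (lam i.1 * lam j.1))) +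
        4 * ∑ i, (∑ j, c i j) ^ 2 + 4 * ∑ j, (∑ i, c i j) ^ 2 := by
    refine (integral_add hI2 (integrable_const (4 * ∑ j, (∑ i, c i j) ^ 2))).trans ?_
    refine congrArg₂ _ ((integral_add (hI1.const_mul 2) (integrable_const _)).trans ?_) (by simp)
    refine congrArg₂ _ ?_ (by simp)
    rw [integral_const_mul,
      integral_finsetSum _ fun i _ => integrable_finsetSum _ fun j _ => hI i j]
    refine congrArg _ (Finset.sum_congr rfl fun i _ => ?_)
    rw [integral_finsetSum _ fun j _ => hI i j]
    refine Finset.sum_congr rfl fun j _ => ?_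
    rw [integral_const_mul, (integrable_score_sq_and_integral_eq hpos U (low_ne_high i j)).2]
  -- Row and column sums lie in `[0, δ]`, so their squares are at most `δ` times themselves. This
  -- keeps the penalty linear in `∑ c`.
  have hsq : ∀ t, 0 ≤ t → t ≤ δ → t ^ 2 ≤ δ * t := fun t h0 h1 => by nlinarith
  have b1 : ∑ i, ∑ j, c i j ^ 2 * (n * ((lam i.1 - lam j.1) ^ 2 / (lam i.1 * lam j.1))) ≤
      2 * ∑ i, ∑ j, c i j := by
    simp only [Finset.mul_sum]
    exact Finset.sum_le_sum fun i _ => Finset.sum_le_sum fun j _ =>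
      sq_mul_information_le hn hpos hc i j
  have b2 : ∑ i, (∑ j, c i j) ^ 2 ≤ δ * ∑ i, ∑ j, c i j := by
    rw [Finset.mul_sum]
    exact Finset.sum_le_sum fun i _ =>
      hsq _ (Finset.sum_nonneg fun j _ => hc.nonneg i j) (hc.sum_high_le i)
  have b3 : ∑ j, (∑ i, c i j) ^ 2 ≤ δ * ∑ i, ∑ j, c i j := by
    have hswap : ∑ i, ∑ j, c i j = ∑ j, ∑ i, c i j := Finset.sum_comm
    rw [hswap, Finset.mul_sum]
    exact Finset.sum_le_sum fun j _ =>
      hsq _ (Finset.sum_nonneg fun i _ => hc.nonneg i j) (hc.sum_low_le j)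
  rw [← ofReal_integral_eq_lintegral_ofReal (hint.const_mul _) (Filter.Eventually.of_forall
    fun X => mul_nonneg (sq_nonneg _) (by unfold penalty; positivity)), integral_const_mul, hval]
  refine ENNReal.ofReal_le_ofReal (mul_le_mul_of_nonneg_left ?_ (sq_nonneg _))
  -- The three parts contribute `4`, `4 δ` and `4 δ` times `∑ c`.
  linarith

theorem measurable_penalty {p n d : ℕ} (lam : Fin p → ℝ) (c : Low p d → High p d → ℝ) :
    Measurable fun z : Orth p × Sample p n => penalty c fun i j => score lam i.1 j.1 z.1 z.2 := by
  have hs : ∀ i j, Measurable fun z : Orth p × Sample p n => score lam i j z.1 z.2 :=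
    fun i j => (continuous_score lam i j).measurable
  unfold penalty
  exact (((Finset.measurable_sum _ fun i _ => Finset.measurable_sum _ fun j _ =>
    ((hs i.1 j.1).pow_const 2).const_mul _).const_mul 2).add_const _).add_const _

theorem measurable_hsNormSq_sub_projLE {p n : ℕ} (d : ℕ) (Phat : Estimator p n) :
    Measurable fun z : Orth p × Sample p n => hsNormSq (Phat.1 z.2 - projLE d z.1) := by
  have hU : ∀ a b, Measurable fun z : Orth p × Sample p n =>
      (z.1 : Matrix (Fin p) (Fin p) ℝ) a b :=
    fun a b => (continuous_coe_apply a b).measurable.comp measurable_fst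
  have hP : ∀ a b, Measurable fun z : Orth p × Sample p n => Phat.1 z.2 a b :=
    fun a b => (Phat.2 a b).comp measurable_snd
  simp only [hsNormSq_eq_sum, Matrix.sub_apply, projLE, Matrix.sum_apply, Matrix.vecMulVec_apply,
    Matrix.col_apply]
  exact Finset.measurable_sum _ fun a _ => Finset.measurable_sum _ fun b _ =>
    ((hP a b).sub (Finset.measurable_sum _ fun i _ => (hU a i).mul (hU b i))).pow_const 2

/-- Every feasible matrix yields a lower bound for the Bayes risk. -/
theorem ofReal_sum_le_bayesRisk {p n d : ℕ} (hn : 1 ≤ n) {lam : Fin p → ℝ} (hpos : ∀ i, 0 < lam i)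
    {δ : ℝ} (hδ : 0 < δ) {c : Low p d → High p d → ℝ} (hc : Feasible n d lam δ c)
    (Phat : Estimator p n) :
    ENNReal.ofReal (1 / (1 + 2 * δ) * ∑ i, ∑ j, c i j) ≤ bayesRisk d lam Phat := by
  set S := ∑ i, ∑ j, c i j with hS
  -- This `θ` maximizes `4 θ S - 4 θ² (1 + 2δ) S`, with maximum `S / (1 + 2δ)`.
  set θ : ℝ := 1 / (2 * (1 + 2 * δ)) with hθ
  have hS0 : 0 ≤ S := Finset.sum_nonneg fun i _ => Finset.sum_nonneg fun j _ => hc.nonneg i j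
  have hprob : ∀ U, IsProbabilityMeasure (model n lam U) := fun U => by
    unfold model; infer_instance
  have hconst : ∀ r : ℝ, ∫⁻ U, ∫⁻ _X, ENNReal.ofReal r ∂(model n lam U) ∂(haarOrth p) =
      ENNReal.ofReal r := fun r => by simp
  have hmeasW : Measurable fun z : Orth p × Sample p n =>
      θ ^ 2 * penalty c fun i j => score lam i.1 j.1 z.1 z.2 :=
    (measurable_penalty lam c).const_mul _
  have hmain : ENNReal.ofReal (4 * θ * S) ≤
      bayesRisk d lam Phat + ENNReal.ofReal (θ ^ 2 * (4 * (1 + 2 * δ) * S)) := by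
    calc ENNReal.ofReal (4 * θ * S)
        = ∫⁻ X : Sample p n, ∫⁻ U, ENNReal.ofReal (dens lam U X * (4 * θ * S)) ∂(haarOrth p) := by
          rw [← lintegral_haarOrth_lintegral_model hpos
            (F := fun _ : Orth p × Sample p n => 4 * θ * S) measurable_const, hconst]
      _ ≤ ∫⁻ X : Sample p n,
          (∫⁻ U, ENNReal.ofReal (dens lam U X * hsNormSq (Phat.1 X - projLE d U)) ∂(haarOrth p) +
          ∫⁻ U, ENNReal.ofReal (dens lam U X *
            (θ ^ 2 * penalty c fun i j => score lam i.1 j.1 U X)) ∂(haarOrth p)) :=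
          lintegral_mono fun X => lintegral_dens_le c X (Phat.1 X)
      _ = (∫⁻ X : Sample p n, ∫⁻ U, ENNReal.ofReal
            (dens lam U X * hsNormSq (Phat.1 X - projLE d U)) ∂(haarOrth p)) +
          ∫⁻ X : Sample p n, ∫⁻ U, ENNReal.ofReal (dens lam U X *
            (θ ^ 2 * penalty c fun i j => score lam i.1 j.1 U X)) ∂(haarOrth p) := by
          refine lintegral_add_right _ ?_
          exact Measurable.lintegral_prod_left'
            (((continuous_dens lam).measurable.mul hmeasW).ennreal_ofReal)
      _ = bayesRisk d lam Phat + ∫⁻ U, ∫⁻ X, ENNReal.ofReal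
            (θ ^ 2 * penalty c fun i j => score lam i.1 j.1 U X) ∂(model n lam U)
            ∂(haarOrth p) := by
          congr 1
          · exact (lintegral_haarOrth_lintegral_model hpos
              (measurable_hsNormSq_sub_projLE d Phat)).symm
          · exact (lintegral_haarOrth_lintegral_model hpos hmeasW).symm
      _ ≤ _ := by
          gcongr
          refine (lintegral_mono fun U => lintegral_penalty_le hn hpos hc θ U).trans ?_
          simp [hS]
  have hval : 1 / (1 + 2 * δ) * S = 4 * θ * S - θ ^ 2 * (4 * (1 + 2 * δ) * S) := by
    rw [hθ]; field_simp; ring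
  -- The subtraction is the truncated one of `ℝ≥0∞` and removes a finite term, so an infinite risk
  -- needs no separate treatment.
  rw [hval, ENNReal.ofReal_sub _ (by positivity)]
  exact tsub_le_iff_right.mpr hmain

/-! ### The maximization problem -/

/-- A continuous objective attains its maximum on a nonempty compact set. Boundedness comes from
nonnegativity and the sum constraints, not from the entry bounds, which may be absent; the zero
matrix is feasible. -/
theorem isGreatest_objectiveValues {p : ℕ} (n d : ℕ) {lam : Fin p → ℝ} (hpos : ∀ i, 0 < lam i)
    {δ : ℝ} (hδ : 0 < δ) :
    IsGreatest (objectiveValues n d lam δ) (sSup (objectiveValues n d lam δ)) := by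
  have hobj : objectiveValues n d lam δ =
      (fun x : Low p d → High p d → ℝ => ∑ i, ∑ j, x i j) '' {x | Feasible n d lam δ x} := by
    ext s
    simp only [objectiveValues, Set.mem_ofPred_eq, Set.mem_image]
    exact ⟨fun ⟨x, hx, hs⟩ => ⟨x, hx, hs.symm⟩, fun ⟨x, hx, hs⟩ => ⟨x, hx, hs.symm⟩⟩
  have hset : {x : Low p d → High p d → ℝ | Feasible n d lam δ x} =
      {x | (∀ i j, 0 ≤ x i j) ∧ (∀ (i : Low p d) (j : High p d), lam i.1 ≠ lam j.1 →
        x i j ≤ 2 / (n : ℝ) * (lam i.1 * lam j.1 / (lam i.1 - lam j.1) ^ 2)) ∧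
        (∀ j, ∑ i, x i j ≤ δ) ∧ ∀ i, ∑ j, x i j ≤ δ} := by
    ext x
    exact ⟨fun h => ⟨h.1, h.2, h.3, h.4⟩, fun h => ⟨h.1, h.2.1, h.2.2.1, h.2.2.2⟩⟩
  have hclosed : IsClosed {x : Low p d → High p d → ℝ | Feasible n d lam δ x} := by
    rw [hset]
    simp only [Set.ofPred_and, Set.ofPred_forall]
    refine IsClosed.inter ?_ (IsClosed.inter ?_ (IsClosed.inter ?_ ?_))
    · exact isClosed_iInter fun i => isClosed_iInter fun j =>
        isClosed_le continuous_const (by fun_prop)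
    · exact isClosed_iInter fun i => isClosed_iInter fun j => isClosed_iInter fun _ =>
        isClosed_le (by fun_prop) continuous_const
    · exact isClosed_iInter fun j => isClosed_le (by fun_prop) continuous_const
    · exact isClosed_iInter fun i => isClosed_le (by fun_prop) continuous_const
  have hcompact : IsCompact {x : Low p d → High p d → ℝ | Feasible n d lam δ x} := by
    refine IsCompact.of_isClosed_subset (isCompact_univ_pi fun _ : Low p d => isCompact_univ_pi
      fun _ : High p d => isCompact_Icc (a := (0 : ℝ)) (b := δ)) hclosed ?_
    intro x hx i _ j _
    exact ⟨hx.nonneg i j, (Finset.single_le_sum (fun j' _ => hx.nonneg i j')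
      (Finset.mem_univ j)).trans (hx.sum_high_le i)⟩
  have hne : {x : Low p d → High p d → ℝ | Feasible n d lam δ x}.Nonempty := by
    refine ⟨fun _ _ => 0, ⟨fun _ _ => le_rfl, fun i j _ => ?_, fun _ => ?_, fun _ => ?_⟩⟩
    · have hi := hpos i.1
      have hj := hpos j.1
      positivity
    · simpa using hδ.le
    · simpa using hδ.le
  rw [hobj]
  exact (hcompact.image (by fun_prop)).isGreatest_sSup (hne.image _)

theorem objectiveValues_one {p : ℕ} (n d : ℕ) (lam : Fin p → ℝ) :
    objectiveValues n d lam 1 = {s : ℝ | ∃ x : Matrix (Low p d) (High p d) ℝ,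
      IsDoublySubstochastic x ∧ EntryBounds n d lam x ∧ s = ∑ i, ∑ j, x i j} := by
  ext s
  exact ⟨fun ⟨x, h, hs⟩ => ⟨x, ⟨h.1, h.3, h.4⟩, h.2, hs⟩,
    fun ⟨x, h, hb, hs⟩ => ⟨x, ⟨h.1, hb, h.2, h.3⟩, hs⟩⟩

end PCABound

end

theorem mainTheorem3 (p n d : ℕ) (hn : 1 ≤ n) (hd : 1 ≤ d) (hdp : d ≤ p)
    (lam : Fin p → ℝ) (hlam : Antitone lam) (hpos : ∀ i, 0 < lam i) :
    (∀ δ : ℝ, 0 < δ →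
      IsGreatest (PCABound.objectiveValues n d lam δ)
        (sSup (PCABound.objectiveValues n d lam δ)) ∧
      ENNReal.ofReal (PCABound.lowerBound n d lam δ) ≤
        ⨅ Phat : PCABound.Estimator p n, PCABound.bayesRisk d lam Phat) ∧
    ∃ M : ℝ,
      IsGreatest {s : ℝ | ∃ x : Matrix (PCABound.Low p d) (PCABound.High p d) ℝ,
        PCABound.IsDoublySubstochastic x ∧ PCABound.EntryBounds n d lam x ∧
        s = ∑ i, ∑ j, x i j} M ∧
      PCABound.lowerBound n d lam 1 = 1 / 3 * M := by
  refine ⟨fun δ hδ => ?_, sSup (PCABound.objectiveValues n d lam 1), ?_, ?_⟩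
  · have hmax := PCABound.isGreatest_objectiveValues n d hpos hδ
    refine ⟨hmax, le_iInf fun Phat => ?_⟩
    -- The weights in the information inequality are taken to be a maximizer.
    obtain ⟨c, hc, hs⟩ := hmax.1
    rw [PCABound.lowerBound, hs]
    exact PCABound.ofReal_sum_le_bayesRisk hn hpos hδ hc Phat
  · rw [← PCABound.objectiveValues_one]
    exact PCABound.isGreatest_objectiveValues n d hpos one_pos
  · rw [PCABound.lowerBound]
    norm_num
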